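/- All spaces are Tychonoff (completely regular and Hausdorff). In the open-open game on a space $X$, in each of the rounds $n=0,1,2,\dots$ player I chooses a non-empty open set $W_n\subset X$ and then player II chooses a non-empty open set $U_n\subset W_n$; player I wins if $\bigcup_{n\ge 0}U_n$ is dense in $X$, and player II wins otherwise. The space $X$ is called $\mathrm{I}$-favorable if player I has a winning strategy in this game (the empty space being regarded as $\mathrm I$-favorable), and it is called extremally disconnected if the closure of every open subset of $X$ is open. **Corollary 1.2.** If $Y$ is an extremally disconnected (Tychonoff) space and $X\subset Y$ is a subset which, with the subspace topology, is $\mathrm I$-favorable, then $X$ is extremally disconnected. -/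

import Mathlib

open TopologicalSpace

/-- A strategy for player I in the open-open game on `X`: to every finite sequence
`(U₀, …, U_{n-1})` of moves of player II it assigns the next open set chosen by player I. -/
def OpenOpenStrategy (X : Type*) [TopologicalSpace X] : Type _ :=
  (n : ℕ) → (Fin n → Opens X) → Opens X

namespace OpenOpenStrategy

variable {X : Type*} [TopologicalSpace X]

/-- The move of player I in round `n` when he follows `σ` and player II has played
`U 0, …, U (n - 1)` so far. -/
def move (σ : OpenOpenStrategy X) (U : ℕ → Opens X) (n : ℕ) : Opens X :=
  σ n (fun i => U i)

/-- In each of the rounds `0, …, n - 1` player II has answered legally to `σ`: his choice `U k` is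
a non-empty open subset of player I's move. -/
def LegalBefore (σ : OpenOpenStrategy X) (U : ℕ → Opens X) (n : ℕ) : Prop :=
  ∀ k < n, (U k : Set X).Nonempty ∧ U k ≤ σ.move U k

/-- `σ` is winning for player I: it always tells him to play a non-empty open set (as the rules of
the game demand), and in every infinite play following `σ` the union of the sets chosen by
player II is dense. On the empty space, where there are no legal moves, every strategy counts as
winning. -/
def IsWinning (σ : OpenOpenStrategy X) : Prop :=
  (Nonempty X → ∀ (U : ℕ → Opens X) (n : ℕ), σ.LegalBefore U n → (σ.move U n : Set X).Nonempty) ∧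
  ∀ U : ℕ → Opens X, (∀ n, σ.LegalBefore U n) → Dense (⋃ n, (U n : Set X))

end OpenOpenStrategy

/-- A space is I-favorable if player I has a winning strategy in the open-open game. -/
def IFavorable (X : Type*) [TopologicalSpace X] : Prop :=
  ∃ σ : OpenOpenStrategy X, σ.IsWinning

/-! Disjoint open sets of `Y` have disjoint closures, so it suffices to separate, by disjoint open
sets of `Y`, dense parts of `U` and of the complement of its closure in `X`. The game supplies
countability: if player II answers with small enough sets, countably many open sets of `Y`, with
closures tracing inside `U`, have traces dense in `U`. Countable covers on both sides, with closures
missing the other side, are then disjointified as in the proof that regular Lindelöf spaces are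
normal. -/

/-- If player I has a winning strategy on a non-empty space, then any family of open sets which
refines every non-empty open set has a countable subfamily with dense union: player II can always
answer with a member of the family. -/
theorem IFavorable.exists_dense_iUnion {X : Type*} [TopologicalSpace X] [Nonempty X]
    (hX : IFavorable X) (P : Opens X → Prop)
    (hP : ∀ W : Opens X, (W : Set X).Nonempty → ∃ Z ≤ W, (Z : Set X).Nonempty ∧ P Z) :
    ∃ U : ℕ → Opens X, (∀ n, P (U n)) ∧ Dense (⋃ n, (U n : Set X)) := by
  obtain ⟨σ, hmove, hdense⟩ := hX
  have hreply : ∀ W : Opens X, ∃ Z : Opens X,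
      (W : Set X).Nonempty → Z ≤ W ∧ (Z : Set X).Nonempty ∧ P Z := fun W => by
    by_cases hW : (W : Set X).Nonempty
    · obtain ⟨Z, hZ⟩ := hP W hW
      exact ⟨Z, fun _ => hZ⟩
    · exact ⟨W, fun h => absurd h hW⟩
  choose reply hreply using hreply
  let U : ℕ → Opens X := Nat.lt_wfRel.wf.fix fun n ih => reply (σ n fun i => ih i i.isLt)
  have hU : ∀ n, U n = reply (σ.move U n) := fun n => WellFounded.fix_eq _ _ n
  have hlegal : ∀ n, σ.LegalBefore U n := by
    intro n
    induction n with
    | zero => exact fun k hk => absurd hk k.not_lt_zero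
    | succ n ih =>
      intro k hk
      rcases Nat.lt_succ_iff_lt_or_eq.mp hk with hk | rfl
      · exact ih k hk
      · have h := hreply _ (hmove inferInstance U k ih)
        rw [← hU] at h
        exact ⟨h.2.1, h.1⟩
  refine ⟨U, fun n => ?_, hdense U hlegal⟩
  rw [hU]
  exact (hreply _ (hmove inferInstance U n (hlegal n))).2.2

/-- An open subset of an I-favorable subspace of a regular space has a dense subset which is
covered by countably many open sets of the ambient space whose closures do not leave the given
subset. -/
theorem IFavorable.exists_isOpen_closure_subset {Y : Type*} [TopologicalSpace Y] [RegularSpace Y]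
    {X : Set Y} [Nonempty X] (hX : IFavorable X) {U : Set X} (hU : IsOpen U) :
    ∃ A : ℕ → Set Y, (∀ n, IsOpen (A n)) ∧ (∀ n, Subtype.val ⁻¹' closure (A n) ⊆ U) ∧
      U ⊆ closure (⋃ n, (Subtype.val ⁻¹' A n : Set X)) := by
  obtain ⟨Z, hZ, hdense⟩ := hX.exists_dense_iUnion
    -- Intersecting `Z` with `U` lets sets that miss `U` qualify with `A = ∅`, so the family refines
    -- every move of player I.
    (fun Z => ∃ A : Set Y, IsOpen A ∧ Subtype.val ⁻¹' closure A ⊆ U ∧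
      (Z : Set X) ∩ U ⊆ Subtype.val ⁻¹' A) <| by
    intro W hW
    by_cases hWU : ((W : Set X) ∩ U).Nonempty
    · obtain ⟨x, hx⟩ := hWU
      obtain ⟨O, hO, hOW⟩ := isOpen_induced_iff.mp (W.isOpen.inter hU)
      have hxO : (x : Y) ∈ O := by rwa [← hOW] at hx
      obtain ⟨C, ⟨hC, hCclosed⟩, hCO⟩ :=
        (closed_nhds_basis (x : Y)).mem_iff.mp (hO.mem_nhds hxO)
      have hsub : (Subtype.val ⁻¹' C : Set X) ⊆ W ∩ U := hOW ▸ Set.preimage_mono hCO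
      refine ⟨⟨Subtype.val ⁻¹' interior C, isOpen_interior.preimage continuous_subtype_val⟩,
        fun y hy => (hsub (interior_subset hy : (y : Y) ∈ C)).1,
        ⟨x, mem_interior_iff_mem_nhds.mpr hC⟩, interior C, isOpen_interior, fun y hy => ?_,
        Set.inter_subset_left⟩
      exact (hsub (closure_minimal interior_subset hCclosed hy : (y : Y) ∈ C)).2
    · refine ⟨W, le_rfl, hW, ∅, isOpen_empty, by simp, ?_⟩
      rw [Set.not_nonempty_iff_eq_empty.mp hWU]
      exact Set.empty_subset _
  choose A hA hAU hZA using hZ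
  refine ⟨A, hA, hAU, (hdense.open_subset_closure_inter hU).trans (closure_mono ?_)⟩
  rintro x ⟨hxU, hx⟩
  obtain ⟨n, hn⟩ := Set.mem_iUnion.mp hx
  exact Set.mem_iUnion.mpr ⟨n, hZA n ⟨hn, hxU⟩⟩

/-- Disjoint open subsets of an I-favorable subspace of a regular space have dense subsets which
are separated by open sets of the ambient space. -/
theorem IFavorable.exists_disjoint_isOpen {Y : Type*} [TopologicalSpace Y] [RegularSpace Y]
    {X : Set Y} [Nonempty X] (hX : IFavorable X) {U V : Set X} (hU : IsOpen U) (hV : IsOpen V)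
    (hUV : Disjoint U V) :
    ∃ G H : Set Y, IsOpen G ∧ IsOpen H ∧ Disjoint G H ∧
      U ⊆ closure (Subtype.val ⁻¹' G) ∧ V ⊆ closure (Subtype.val ⁻¹' H) := by
  obtain ⟨A, hA, hAU, hUA⟩ := hX.exists_isOpen_closure_subset hU
  obtain ⟨B, hB, hBV, hVB⟩ := hX.exists_isOpen_closure_subset hV
  let S : Set X := ⋃ n, Subtype.val ⁻¹' A n
  let T : Set X := ⋃ n, Subtype.val ⁻¹' B n
  have hSU : S ⊆ U := Set.iUnion_subset fun n =>
    (Set.preimage_mono subset_closure).trans (hAU n)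
  have hTV : T ⊆ V := Set.iUnion_subset fun n =>
    (Set.preimage_mono subset_closure).trans (hBV n)
  have hST : HasSeparatingCover (Subtype.val '' S) (Subtype.val '' T) := by
    refine ⟨A, ?_, fun n => ⟨hA n, ?_⟩⟩
    · simp only [S, ← Set.preimage_iUnion, Set.image_preimage_subset]
    · rw [Set.disjoint_left]
      rintro _ hy ⟨x, hx, rfl⟩
      exact Set.disjoint_left.mp hUV (hAU n hy) (hTV hx)
  have hTS : HasSeparatingCover (Subtype.val '' T) (Subtype.val '' S) := by
    refine ⟨B, ?_, fun n => ⟨hB n, ?_⟩⟩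
    · simp only [T, ← Set.preimage_iUnion, Set.image_preimage_subset]
    · rw [Set.disjoint_left]
      rintro _ hy ⟨x, hx, rfl⟩
      exact Set.disjoint_left.mp hUV (hSU hx) (hBV n hy)
  obtain ⟨G, H, hG, hH, hSG, hTH, hGH⟩ :=
    hasSeparatingCovers_iff_separatedNhds.mp ⟨hST, hTS⟩
  exact ⟨G, H, hG, hH, hGH, hUA.trans (closure_mono (Set.image_subset_iff.mp hSG)),
    hVB.trans (closure_mono (Set.image_subset_iff.mp hTH))⟩

theorem corollary1p2 {Y : Type*} [TopologicalSpace Y] [T35Space Y] [ExtremallyDisconnected Y]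
    (X : Set Y) (hX : IFavorable X) : ExtremallyDisconnected X := by
  refine ⟨fun U hU => ?_⟩
  rcases isEmpty_or_nonempty X with hE | hE
  · rw [Set.eq_empty_of_isEmpty (closure U)]
    exact isOpen_empty
  obtain ⟨G, H, hG, hH, hGH, hUG, hVH⟩ := hX.exists_disjoint_isOpen hU
    isClosed_closure.isOpen_compl (disjoint_compl_right.mono_left subset_closure)
  have hdisj := ExtremallyDisconnected.disjoint_closure_of_disjoint_isOpen hGH hG hH
  -- A point in the closures of both `U` and the complement of `closure U` would lie in `closure G ∩
  -- closure H`, which is empty.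
  rw [← isClosed_compl_iff, ← closure_subset_iff_isClosed]
  intro x hxV hxU
  have hG' := continuous_subtype_val.closure_preimage_subset G
    (closure_minimal hUG isClosed_closure hxU)
  have hH' := continuous_subtype_val.closure_preimage_subset H
    (closure_minimal hVH isClosed_closure hxV)
  exact Set.disjoint_left.mp hdisj hG' hH'
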